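/- Let $\mathbb A$ be a finite-dimensional unital real normed division algebra, i.e. a finite-dimensional real inner product space with a bilinear, not necessarily associative, unital product satisfying $\|xy\|=\|x\|\,\|y\|$ (such as $\mathbb C$, $\mathbb H$, $\mathbb O$), and let $d_A=\dim_{\mathbb R}\mathbb A$. Let $P(x)=\sum_k a_kx^k$ be a nonconstant polynomial with coefficients $a_k\in\mathbb A$, with root variety $V(P)=\{x\in\mathbb A: P(x)=0\}$. For $T>0$ let $$Z(T)=\int_{\mathbb A}e^{-\|P(x)\|^2/T}\,dx,\qquad d\mu_T=\tfrac1{Z(T)}e^{-\|P(x)\|^2/T}dx,\qquad F(T)=-T\log Z(T),\qquad S(T)=-F'(T)$$ be the partition function, the Gibbs measure, the free energy and the entropy. For every $T>0$, $\mu_T$ is a well-defined probability measure and $F$ is differentiable at $T$. As $T\to0^+$ (with $P$ fixed): 1. (Degenerate manifolds.) Suppose that $V(P)$ is a smooth embedded submanifold of $\mathbb A$, whose components may have different dimensions, the largest of them being $d_M>0$, and that $V(P)$ is a Morse–Bott minimum set of $\|P\|^2$: at each $x\in V(P)$ the real Jacobian $J_P(x)$ has rank $d_A-\dim_xV(P)$.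 Then the $d_M$-dimensional volume satisfies $0<\operatorname{Vol}(V(P))<\infty$, and $$S(T)=\frac{d_A-d_M}{2}\log T+\log\operatorname{Vol}(V(P))+O(1).$$ 2. (Isolated roots.) Suppose that $V(P)$ is nonempty, that all its points are isolated, and that they are nondegenerate (Morse) minima of $\|P\|^2$, i.e. $J_P(x)$ has rank $d_A$ at each root $x$. Then $$S(T)=\frac{d_A}{2}\log T+O(1).$$ -/

import Mathlib

open MeasureTheory Filter Topology Asymptotics
open scoped ContDiff

/-- A unital, not necessarily associative ring with a multiplicative norm `‖x * y‖ = ‖x‖ * ‖y‖`.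
Together with `[InnerProductSpace ℝ A] [FiniteDimensional ℝ A] [IsScalarTower ℝ A A]
[SMulCommClass ℝ A A]` (the norm is Euclidean and the product is real bilinear) this says that `A`
is a real normed division algebra; these are, up to isomorphism, the real numbers, the complex
numbers, the quaternions and the octonions (and the zero ring). -/
class MulNormedNonAssocRing (A : Type*) extends Norm A, NonAssocRing A, MetricSpace A where
  /-- The distance is induced by the norm. -/
  dist_eq : ∀ x y : A, dist x y = ‖-x + y‖
  /-- The norm is multiplicative. -/
  norm_mul : ∀ x y : A, ‖x * y‖ = ‖x‖ * ‖y‖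

instance MulNormedNonAssocRing.toNormedAddCommGroup {A : Type*} [h : MulNormedNonAssocRing A] :
    NormedAddCommGroup A :=
  { h with }

namespace DivAlgPoly

noncomputable section

section Algebra

variable {A : Type*} [MulNormedNonAssocRing A]

/-- The power `x ^ k` in a non-associative ring, `x ^ (k + 1) = x ^ k * x`. (Normed division
algebras are power-associative, so the bracketing does not matter.) -/
def pow (x : A) : ℕ → A
  | 0 => 1
  | k + 1 => pow x k * x

/-- The value `P(x) = ∑ aₖ x ^ k` of the polynomial with (left) coefficients `aₖ = P k`. -/
def eval (P : ℕ →₀ A) (x : A) : A :=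
  P.sum fun k a => a * pow x k

/-- The root variety `V(P) = {x | P(x) = 0}`. -/
def rootSet (P : ℕ →₀ A) : Set A :=
  {x | eval P x = 0}

/-- The potential `‖P(x)‖ ^ 2`. -/
def potential (P : ℕ →₀ A) (x : A) : ℝ :=
  ‖eval P x‖ ^ 2

end Algebra

section Geometry

/-- Near its point `x`, the set `S` is a smooth embedded submanifold of dimension `k`: a smooth
local diffeomorphism of the ambient space defined around `x` carries `S` to a `k`-dimensional
linear subspace. -/
def IsSmoothSubmanifoldAt {E : Type*} [NormedAddCommGroup E] [NormedSpace ℝ E]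
    (S : Set E) (k : ℕ) (x : E) : Prop :=
  x ∈ S ∧ ∃ (φ : OpenPartialHomeomorph E E) (W : Submodule ℝ E),
    x ∈ φ.source ∧ ContDiffOn ℝ ∞ φ φ.source ∧ ContDiffOn ℝ ∞ φ.symm φ.target ∧
    Module.finrank ℝ W = k ∧ φ '' (φ.source ∩ S) = φ.target ∩ (W : Set E)

variable {A : Type*} [MulNormedNonAssocRing A] [InnerProductSpace ℝ A]

/-- The rank of the Jacobian at `x` of `P`, seen as a map between real vector spaces. -/
def jacobianRank (P : ℕ →₀ A) (x : A) : ℕ :=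
  Module.finrank ℝ (LinearMap.range (fderiv ℝ (eval P) x : A →ₗ[ℝ] A))

/-- The root variety of `P` is a nonempty manifold of dimension `d` (the maximum of the dimensions
of its connected components) which consists of Morse-Bott minima of the potential: at each root the
corank of the Jacobian is the dimension of the root variety there, i.e. the Hessian
`2 * Jᵀ * J` of the potential is nondegenerate in the normal directions. -/
structure IsMorseBottRootManifold (P : ℕ →₀ A) (d : ℕ) : Prop where
  nondegenerate : ∀ x ∈ rootSet P, ∃ k ≤ d, IsSmoothSubmanifoldAt (rootSet P) k x ∧
    jacobianRank P x + k = Module.finrank ℝ A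
  dim_attained : ∃ x, IsSmoothSubmanifoldAt (rootSet P) d x

/-- `P` has roots, they are all isolated, and they are Morse (nondegenerate) minima of the
potential, i.e. the Jacobian of `P` has full rank there. -/
structure HasIsolatedMorseRoots (P : ℕ →₀ A) : Prop where
  nonempty : (rootSet P).Nonempty
  isolated : ∀ x ∈ rootSet P, ∃ U ∈ 𝓝 x, rootSet P ∩ U = {x}
  nondegenerate : ∀ x ∈ rootSet P, jacobianRank P x = Module.finrank ℝ A

end Geometry

section Thermodynamics

variable {A : Type*} [MulNormedNonAssocRing A] [InnerProductSpace ℝ A] [FiniteDimensional ℝ A]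
  [MeasurableSpace A] [BorelSpace A]

/-- The partition function `Z(T) = ∫ exp (-‖P(x)‖ ^ 2 / T) dx`, for Lebesgue measure on `A`. -/
def partitionFunction (P : ℕ →₀ A) (T : ℝ) : ℝ :=
  ∫ x : A, Real.exp (-potential P x / T)

/-- The Gibbs measure `dμ_T(x) = Z(T)⁻¹ exp (-‖P(x)‖ ^ 2 / T) dx`. -/
def gibbsMeasure (P : ℕ →₀ A) (T : ℝ) : Measure A :=
  volume.withDensity fun x =>
    ENNReal.ofReal ((partitionFunction P T)⁻¹ * Real.exp (-potential P x / T))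

/-- The Helmholtz free energy `F(T) = -T log Z(T)`. -/
def freeEnergy (P : ℕ →₀ A) (T : ℝ) : ℝ :=
  -T * Real.log (partitionFunction P T)

/-- The entropy `S(T) = -∂F/∂T`. -/
def entropy (P : ℕ →₀ A) (T : ℝ) : ℝ :=
  -deriv (freeEnergy P) T

/-- The `d`-dimensional volume of the root variety, as the `d`-dimensional Hausdorff measure with
the normalization that agrees with Lebesgue measure on `d`-dimensional Euclidean spaces. -/
def rootVolume (P : ℕ →₀ A) (d : ℕ) : ENNReal :=
  Measure.euclideanHausdorffMeasure d (rootSet P)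

end Thermodynamics

end

end DivAlgPoly

/-! Differentiating under the integral gives `S = log Z + u`, where `u` is the `μ_T`-mean of `‖P‖² /
T`. Since `t e⁻ᵗ ≤ 2 e^(-t/2)`, `0 ≤ u ≤ 2 Z(2T) / Z(T)`. An error of `O(1)` therefore only needs
two-sided bounds `Z(T) ≍ T^((d_A - d)/2)`, not an asymptotic expansion; `log Vol` is a constant, so
its finiteness and positivity are separate claims.

Upper bound (`gibbsBound_univ`): near a root, bi-Lipschitz coordinates bound the integrand by a
Gaussian in as many directions as the Jacobian has rank; away from the roots the mass is
exponentially small; the growth of `‖P‖` reduces everything to a compact ball.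

Lower bound (`IsSmoothSubmanifoldAt.exists_le_gibbsMass`): in a chart at a point of top dimension
`d`, a box of width of order `√T` in the normal directions has `‖P‖² / T` bounded. Isolated roots
are the case `d = 0`. -/

namespace DivAlgPoly

/-! ### Hausdorff measure under Lipschitz and expanding maps -/

section Hausdorff

variable {X Y : Type*} [MetricSpace X] [MeasurableSpace X] [BorelSpace X]
  [MetricSpace Y] [MeasurableSpace Y] [BorelSpace Y]

theorem euclideanHausdorffMeasure_image_le_of_lipschitzOnWith {f : X → Y} {s : Set X} {K : NNReal}
    (hf : LipschitzOnWith K f s) (d : ℕ) :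
    Measure.euclideanHausdorffMeasure d (f '' s) ≤
      (K : ENNReal) ^ d * Measure.euclideanHausdorffMeasure d s := by
  rw [Measure.euclideanHausdorffMeasure_def, Measure.euclideanHausdorffMeasure_def,
    Measure.smul_apply, Measure.smul_apply, mul_smul_comm]
  gcongr
  simpa using hf.hausdorffMeasure_image_le (d := (d : ℝ)) (by positivity)

/-- The hypothesis makes `f` injective on `s` with a `K`-Lipschitz inverse, to which the preceding
lemma applies. -/
theorem euclideanHausdorffMeasure_le_of_dist_le {f : X → Y} {s : Set X} {K : NNReal}
    (hf : ∀ x ∈ s, ∀ y ∈ s, dist x y ≤ K * dist (f x) (f y)) (d : ℕ) :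
    Measure.euclideanHausdorffMeasure d s ≤
      (K : ENNReal) ^ d * Measure.euclideanHausdorffMeasure d (f '' s) := by
  rcases s.eq_empty_or_nonempty with rfl | ⟨x₀, hx₀⟩
  · simp
  have : Nonempty X := ⟨x₀⟩
  have hinj : Set.InjOn f s := fun x hx y hy h => by
    have := hf x hx y hy
    rw [h, dist_self, mul_zero] at this
    exact dist_le_zero.1 this
  have hlip : LipschitzOnWith K (Function.invFunOn f s) (f '' s) := by
    refine LipschitzOnWith.of_dist_le_mul ?_
    rintro _ ⟨x, hx, rfl⟩ _ ⟨y, hy, rfl⟩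
    rw [hinj.leftInvOn_invFunOn hx, hinj.leftInvOn_invFunOn hy]
    exact hf x hx y hy
  have := euclideanHausdorffMeasure_image_le_of_lipschitzOnWith hlip d
  rwa [hinj.leftInvOn_invFunOn.image_image] at this

end Hausdorff

/-! ### Volume and Gaussian integrals in an orthogonal splitting -/

section Orthogonal

theorem orthogonalProjectionOnto_add_orthogonal {E : Type*} [NormedAddCommGroup E]
    [InnerProductSpace ℝ E] [FiniteDimensional ℝ E] (W : Submodule ℝ E) (z : E) :
    (W.orthogonalProjectionOnto z : E) + Wᗮ.orthogonalProjectionOnto z = z :=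
  W.starProjection_add_starProjection_orthogonal z

variable {E : Type*} [NormedAddCommGroup E] [InnerProductSpace ℝ E] [FiniteDimensional ℝ E]
  [MeasurableSpace E] [BorelSpace E]

theorem volume_image_le_of_lipschitzOnWith {f : E → E} {s : Set E} {K : NNReal}
    (hf : LipschitzOnWith K f s) :
    volume (f '' s) ≤ (K : ENNReal) ^ Module.finrank ℝ E * volume s := by
  rw [← InnerProductSpace.euclideanHausdorffMeasure_eq_volume]
  exact euclideanHausdorffMeasure_image_le_of_lipschitzOnWith hf _

theorem volume_le_of_dist_le {f : E → E} {s : Set E} {K : NNReal}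
    (hf : ∀ x ∈ s, ∀ y ∈ s, dist x y ≤ K * dist (f x) (f y)) :
    volume s ≤ (K : ENNReal) ^ Module.finrank ℝ E * volume (f '' s) := by
  rw [← InnerProductSpace.euclideanHausdorffMeasure_eq_volume]
  exact euclideanHausdorffMeasure_le_of_dist_le hf _

theorem measurePreserving_orthogonalProjectionOnto_prod (W : Submodule ℝ E) :
    MeasurePreserving (fun z : E =>
      (W.orthogonalProjectionOnto z, Wᗮ.orthogonalProjectionOnto z)) volume
      (volume.prod volume) := by
  have h := (WithLp.volume_preserving_ofLp W Wᗮ).comp (g := WithLp.ofLp)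
    (f := W.orthogonalDecomposition) W.orthogonalDecomposition.measurePreserving
  have e : WithLp.ofLp ∘ W.orthogonalDecomposition =
      fun z : E => (W.orthogonalProjectionOnto z, Wᗮ.orthogonalProjectionOnto z) := by
    ext z <;> simp
  rw [e] at h
  exact h

/-- The volume of a product of a ball in `W` and a ball in `Wᗮ`. -/
theorem volume_orthogonal_box (W : Submodule ℝ E) (z₀ : E) {r s : ℝ} (hs : 0 < s) :
    volume {z : E | ‖W.orthogonalProjectionOnto (z - z₀)‖ < r ∧
        ‖Wᗮ.orthogonalProjectionOnto (z - z₀)‖ < r * s} =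
      volume (Metric.ball (0 : W) r) *
        (ENNReal.ofReal (s ^ Module.finrank ℝ Wᗮ) * volume (Metric.ball (0 : Wᗮ) r)) := by
  have h1 := measurePreserving_orthogonalProjectionOnto_prod W
  have h2 := (h1.comp (measurePreserving_sub_right volume z₀)).measure_preimage
    (s := Metric.ball (0 : W) r ×ˢ Metric.ball (0 : Wᗮ) (r * s))
    (Metric.isOpen_ball.measurableSet.prod Metric.isOpen_ball.measurableSet).nullMeasurableSet
  rw [Measure.prod_prod, mul_comm r s, Measure.addHaar_ball_mul_of_pos _ _ hs] at h2
  rw [← h2]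
  congr 1
  ext z
  simp [mul_comm]

theorem integrable_exp_neg_mul_sq_norm {b : ℝ} (hb : 0 < b) :
    Integrable fun v : E => Real.exp (-b * ‖v‖ ^ 2) := by
  have := GaussianFourier.integrable_cexp_neg_mul_sq_norm_add (V := E) (b := (b : ℂ)) (by simpa)
    0 0
  simpa [← Complex.ofReal_pow, ← Complex.ofReal_mul, ← Complex.ofReal_neg, Complex.norm_exp]
    using this.norm

/-- The ball lies in the cylinder over its projection to `W`; on the cylinder the integral factors,
with a full Gaussian integral over `Wᗮ`. -/
theorem setLIntegral_gaussian_orthogonal_le (W : Submodule ℝ E) (z₀ : E) (r : ℝ) {b : ℝ}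
    (hb : 0 < b) :
    ∫⁻ z in Metric.ball z₀ r,
        ENNReal.ofReal (Real.exp (-b * ‖Wᗮ.orthogonalProjectionOnto z‖ ^ 2)) ≤
      volume (Metric.ball (W.orthogonalProjectionOnto z₀) r) *
        ENNReal.ofReal ((Real.pi / b) ^ (Module.finrank ℝ Wᗮ / 2 : ℝ)) := by
  have h1 := measurePreserving_orthogonalProjectionOnto_prod W
  have hm : Measurable fun u : Wᗮ => ENNReal.ofReal (Real.exp (-b * ‖u‖ ^ 2)) := by fun_prop
  calc ∫⁻ z in Metric.ball z₀ r,
        ENNReal.ofReal (Real.exp (-b * ‖Wᗮ.orthogonalProjectionOnto z‖ ^ 2))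
      ≤ ∫⁻ z : E, (Metric.ball (W.orthogonalProjectionOnto z₀) r).indicator 1
            (W.orthogonalProjectionOnto z) *
          ENNReal.ofReal (Real.exp (-b * ‖Wᗮ.orthogonalProjectionOnto z‖ ^ 2)) := by
        rw [← lintegral_indicator Metric.isOpen_ball.measurableSet]
        refine lintegral_mono fun z => ?_
        classical
        rw [Set.indicator_apply]
        split_ifs with hz
        · have : W.orthogonalProjectionOnto z ∈ Metric.ball (W.orthogonalProjectionOnto z₀) r := by
            rw [mem_ball_iff_norm, ← map_sub]
            exact (W.norm_orthogonalProjectionOnto_apply_le _).trans_lt (mem_ball_iff_norm.1 hz)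
          rw [Set.indicator_of_mem this, Pi.one_apply, one_mul]
        · exact bot_le
    _ = ∫⁻ p : W × Wᗮ, (Metric.ball (W.orthogonalProjectionOnto z₀) r).indicator 1 p.1 *
          ENNReal.ofReal (Real.exp (-b * ‖p.2‖ ^ 2)) ∂(volume.prod volume) :=
        h1.lintegral_comp (f := fun p : W × Wᗮ =>
          (Metric.ball (W.orthogonalProjectionOnto z₀) r).indicator 1 p.1 *
          ENNReal.ofReal (Real.exp (-b * ‖p.2‖ ^ 2)))
          (((measurable_one.indicator Metric.isOpen_ball.measurableSet).comp measurable_fst).mul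
            (hm.comp measurable_snd))
    _ = _ := by
        rw [lintegral_prod_mul (measurable_one.indicator
          Metric.isOpen_ball.measurableSet).aemeasurable hm.aemeasurable,
          lintegral_indicator_one Metric.isOpen_ball.measurableSet,
          ← GaussianFourier.integral_rexp_neg_mul_sq_norm hb,
          ofReal_integral_eq_lintegral_ofReal]
        · exact integrable_exp_neg_mul_sq_norm hb
        · exact ae_of_all _ fun _ => (Real.exp_pos _).le

end Orthogonal

/-! ### Bi-Lipschitz coordinates adapted to the kernel of the derivative -/

section LocalCoordinates

variable {E F : Type*} [NormedAddCommGroup E] [InnerProductSpace ℝ E] [FiniteDimensional ℝ E]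
  [NormedAddCommGroup F] [NormedSpace ℝ F] [FiniteDimensional ℝ F]

/-- `J` is injective on `J.kerᗮ`, so it has a left inverse there; `G` is that inverse followed by
the inclusion. -/
theorem exists_clm_comp_eq_orthogonalProjection (J : E →L[ℝ] F) :
    ∃ G : F →L[ℝ] E, ∀ x, G (J x) + J.ker.orthogonalProjectionOnto x = x := by
  obtain ⟨G, hG⟩ := ((J : E →ₗ[ℝ] F).comp J.kerᗮ.subtype).exists_leftInverse_of_injective (by
    rw [LinearMap.ker_eq_bot']
    intro u hu
    have h1 : (u : E) ∈ J.ker := hu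
    have := J.ker.inner_right_of_mem_orthogonal h1 u.2
    exact Subtype.ext (inner_self_eq_zero.1 this))
  refine ⟨LinearMap.toContinuousLinearMap (J.kerᗮ.subtype.comp G), fun x => ?_⟩
  have hx := orthogonalProjectionOnto_add_orthogonal J.ker x
  have hJ : J x = J (J.kerᗮ.orthogonalProjectionOnto x : E) := by
    conv_lhs => rw [← hx]
    rw [map_add, show J (J.ker.orthogonalProjectionOnto x : E) = 0 from
      (J.ker.orthogonalProjectionOnto x).2, zero_add]
  have := LinearMap.congr_fun hG (J.kerᗮ.orthogonalProjectionOnto x)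
  rw [hJ]
  simp only [LinearMap.comp_apply, Submodule.subtype_apply, ContinuousLinearMap.coe_coe,
    LinearMap.id_apply] at this
  rw [LinearMap.coe_toContinuousLinearMap', LinearMap.comp_apply, this, add_comm]
  exact hx

/-- Near each point, a `C¹` map `g` is controlled from below by the components, orthogonal to the
kernel of the derivative, of suitable bi-Lipschitz coordinates. -/
theorem exists_local_coordinates {g : E → F} (hg : ContDiff ℝ 1 g) (x : E) :
    ∃ Φ : E → E, Continuous Φ ∧ ∃ c : ℝ, 0 < c ∧ ∃ U ∈ 𝓝 x, IsOpen U ∧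
      Set.MapsTo Φ U (Metric.ball (Φ x) 1) ∧
      (∀ y ∈ U, ∀ z ∈ U, dist y z ≤ (2 : NNReal) * dist (Φ y) (Φ z)) ∧
      (∀ y, ‖(fderiv ℝ g x).kerᗮ.orthogonalProjectionOnto (Φ y)‖ ≤ c * ‖g y‖) ∧
      (∀ y, g y = 0 → Φ y ∈ (fderiv ℝ g x).ker) := by
  set J := fderiv ℝ g x with hJ
  obtain ⟨G, hG⟩ := exists_clm_comp_eq_orthogonalProjection J
  -- `Φ` keeps the kernel component of `y` and adds `G (g y)`. Its derivative at `x` is the identity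
  -- by `hG`, and it sends zeros of `g` into the kernel.
  set Φ : E → E := fun y => G (g y) + J.ker.orthogonalProjectionOnto y with hΦ
  have hcont : Continuous Φ := by
    have := hg.continuous
    fun_prop
  have hstrict : HasStrictFDerivAt Φ (ContinuousLinearMap.id ℝ E) x := by
    have h1 : HasStrictFDerivAt g J x := hg.contDiffAt.hasStrictFDerivAt one_ne_zero
    have h2 := (G.hasStrictFDerivAt.comp x h1).add
      (J.ker.subtypeL.comp J.ker.orthogonalProjectionOnto).hasStrictFDerivAt
    refine h2.congr_fderiv ?_
    ext y
    exact hG y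
  -- Deviating from the identity by at most half the distance makes the inverse 2-Lipschitz.
  obtain ⟨s, hs, happ⟩ := hstrict.approximates_deriv_on_nhds (c := 1 / 2) (Or.inr (by norm_num))
  obtain ⟨U, hUs, hUo, hxU⟩ := mem_nhds_iff.1
    (inter_mem hs (hcont.continuousAt.preimage_mem_nhds (Metric.ball_mem_nhds (Φ x) one_pos)))
  refine ⟨Φ, hcont, ‖G‖ + 1, by positivity, U, hUo.mem_nhds hxU, hUo, fun y hy => (hUs hy).2,
    fun y hy z hz => ?_, fun y => ?_, fun y hy => ?_⟩
  · have h1 := happ y (hUs hy).1 z (hUs hz).1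
    rw [dist_eq_norm, dist_eq_norm]
    have h2 : ‖y - z‖ ≤ ‖Φ y - Φ z‖ + ‖Φ y - Φ z - (y - z)‖ := by
      have := norm_sub_le (Φ y - Φ z) (Φ y - Φ z - (y - z))
      simpa using this
    simp only [ContinuousLinearMap.id_apply] at h1
    push_cast at h1 ⊢
    linarith
  · have h0 : J.kerᗮ.orthogonalProjectionOnto (J.ker.orthogonalProjectionOnto y : E) = 0 :=
      Submodule.orthogonalProjectionOnto_orthogonal_apply_eq_zero
        (J.ker.orthogonalProjectionOnto y).2
    rw [hΦ]
    simp only [map_add, h0, add_zero]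
    calc _ ≤ ‖G (g y)‖ := Submodule.norm_orthogonalProjectionOnto_apply_le _ _
      _ ≤ ‖G‖ * ‖g y‖ := G.le_opNorm _
      _ ≤ _ := by gcongr; linarith
  · simp only [hΦ, hy, map_zero, zero_add]
    exact (J.ker.orthogonalProjectionOnto y).2

end LocalCoordinates

/-! ### Upper bounds: Gibbs mass and volume of the zero set -/

section Laplace

variable {E F : Type*} [NormedAddCommGroup E] [InnerProductSpace ℝ E] [FiniteDimensional ℝ E]
  [MeasurableSpace E] [BorelSpace E]
  [NormedAddCommGroup F]

/-- The unnormalized Gibbs mass of `s` for the potential `‖g‖ ^ 2` at temperature `T`. -/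
noncomputable def gibbsMass (g : E → F) (T : ℝ) (s : Set E) : ENNReal :=
  ∫⁻ y in s, ENNReal.ofReal (Real.exp (-‖g y‖ ^ 2 / T))

/-- The Gibbs mass of `s` is `O(T ^ (m / 2))` for `0 < T ≤ 1`. -/
def GibbsBound (g : E → F) (m : ℕ) (s : Set E) : Prop :=
  ∃ C : ENNReal, C ≠ ⊤ ∧ ∀ T : ℝ, 0 < T → T ≤ 1 →
    gibbsMass g T s ≤ C * ENNReal.ofReal (√T ^ m)

theorem GibbsBound.mono {g : E → F} {m : ℕ} {s t : Set E} (hst : s ⊆ t) (h : GibbsBound g m t) :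
    GibbsBound g m s := by
  obtain ⟨C, hC, h⟩ := h
  exact ⟨C, hC, fun T hT hT1 => (lintegral_mono_set hst).trans (h T hT hT1)⟩

theorem GibbsBound.union {g : E → F} {m : ℕ} {s t : Set E} (hs : GibbsBound g m s)
    (ht : GibbsBound g m t) : GibbsBound g m (s ∪ t) := by
  obtain ⟨C, hC, hs⟩ := hs
  obtain ⟨D, hD, ht⟩ := ht
  refine ⟨C + D, ENNReal.add_ne_top.2 ⟨hC, hD⟩, fun T hT hT1 => ?_⟩
  rw [add_mul]
  exact (lintegral_union_le _ s t).trans (add_le_add (hs T hT hT1) (ht T hT hT1))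

/-- In the coordinates `Φ` the integrand is at most `exp (-‖v‖² / (c² T))`, with `v` the component
orthogonal to the kernel; the rank is the dimension of the `v`-space. -/
theorem exists_mem_nhds_gibbsBound [NormedSpace ℝ F] [FiniteDimensional ℝ F] {g : E → F}
    (hg : ContDiff ℝ 1 g) (x : E) {m : ℕ}
    (hm : m ≤ Module.finrank ℝ (LinearMap.range (fderiv ℝ g x : E →ₗ[ℝ] F))) :
    ∃ U ∈ 𝓝 x, GibbsBound g m U := by
  obtain ⟨Φ, hΦ, c, hc, U, hU, hUo, hmaps, hdist, hnorm, -⟩ := exists_local_coordinates hg x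
  set W := (fderiv ℝ g x).ker with hW
  have hrank : m ≤ Module.finrank ℝ Wᗮ := by
    have h1 := W.finrank_add_finrank_orthogonal
    have h2 := LinearMap.finrank_range_add_finrank_ker (fderiv ℝ g x : E →ₗ[ℝ] F)
    change _ + Module.finrank ℝ W = _ at h2
    omega
  set r := Module.finrank ℝ Wᗮ with hr
  refine ⟨U, hU, (2 : ENNReal) ^ Module.finrank ℝ E *
    (volume (Metric.ball (W.orthogonalProjectionOnto (Φ x)) 1) *
      ENNReal.ofReal (√(Real.pi * c ^ 2) ^ r)), ?_, fun T hT hT1 => ?_⟩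
  · exact ENNReal.mul_ne_top (by simp)
      (ENNReal.mul_ne_top Metric.isBounded_ball.measure_lt_top.ne ENNReal.ofReal_ne_top)
  have hb : 0 < 1 / (c ^ 2 * T) := by positivity
  set h : E → ENNReal := fun z =>
    ENNReal.ofReal (Real.exp (-(1 / (c ^ 2 * T)) * ‖Wᗮ.orthogonalProjectionOnto z‖ ^ 2)) with hh
  have hmeas : Measurable h := by
    have : Continuous fun z => Wᗮ.orthogonalProjectionOnto z := by fun_prop
    have := this.measurable
    fun_prop
  -- The 2-Lipschitz inverse replaces the change of variables formula: an inequality of measures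
  -- suffices.
  have hmap : (volume.restrict U).map Φ ≤
      (2 : ENNReal) ^ Module.finrank ℝ E • volume.restrict (Metric.ball (Φ x) 1) := by
    refine Measure.le_iff.2 fun B hB => ?_
    rw [Measure.map_apply hΦ.measurable hB, Measure.restrict_apply (hΦ.measurable hB),
      Measure.smul_apply, smul_eq_mul, Measure.restrict_apply hB]
    refine (volume_le_of_dist_le (f := Φ) (K := 2)
      fun y hy z hz => hdist y hy.2 z hz.2).trans ?_
    gcongr
    · simp
    · rintro _ ⟨y, hy, rfl⟩
      exact ⟨hy.1, hmaps hy.2⟩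
  have hπ : (Real.pi / (1 / (c ^ 2 * T))) ^ (r / 2 : ℝ) = √(Real.pi * c ^ 2) ^ r * √T ^ r := by
    rw [← mul_pow, ← Real.sqrt_mul (by positivity), Real.sqrt_eq_rpow, ← Real.rpow_mul_natCast
      (by positivity)]
    congr 1
    · field_simp
    · ring
  calc gibbsMass g T U ≤ ∫⁻ y in U, h (Φ y) := by
        refine lintegral_mono fun y => ENNReal.ofReal_le_ofReal (Real.exp_le_exp.2 ?_)
        have h1 : ‖Wᗮ.orthogonalProjectionOnto (Φ y)‖ ^ 2 ≤ (c * ‖g y‖) ^ 2 :=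
          pow_le_pow_left₀ (norm_nonneg _) (hnorm y) 2
        rw [neg_div, neg_mul, neg_le_neg_iff, div_mul_eq_mul_div, one_mul,
          div_le_div_iff₀ (by positivity) hT]
        nlinarith
    _ = ∫⁻ z, h z ∂((volume.restrict U).map Φ) := (lintegral_map hmeas hΦ.measurable).symm
    _ ≤ ∫⁻ z, h z ∂((2 : ENNReal) ^ Module.finrank ℝ E •
          volume.restrict (Metric.ball (Φ x) 1)) := lintegral_mono' hmap le_rfl
    _ = (2 : ENNReal) ^ Module.finrank ℝ E * ∫⁻ z in Metric.ball (Φ x) 1, h z :=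
        lintegral_smul_measure _ _
    _ ≤ (2 : ENNReal) ^ Module.finrank ℝ E *
          (volume (Metric.ball (W.orthogonalProjectionOnto (Φ x)) 1) *
            ENNReal.ofReal ((Real.pi / (1 / (c ^ 2 * T))) ^ (r / 2 : ℝ))) := by
        gcongr
        exact setLIntegral_gaussian_orthogonal_le W (Φ x) 1 hb
    _ ≤ _ := by
        rw [hπ, ENNReal.ofReal_mul (by positivity), mul_assoc, mul_assoc]
        refine mul_le_mul_right (mul_le_mul_right (mul_le_mul_right
          (ENNReal.ofReal_le_ofReal ?_) _) _) _
        -- A rank larger than `m` only makes the mass smaller, as `T ≤ 1`. This covers root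
        -- components of lower dimension.
        exact pow_le_pow_of_le_one (Real.sqrt_nonneg _) (Real.sqrt_le_one.2 hT1) hrank

/-- Follows from `xᵐ / m! ≤ eˣ` at `x = δ / T` and `T ≤ √T`. -/
theorem exp_neg_div_le_sqrt_pow {δ T : ℝ} (hδ : 0 < δ) (hT : 0 < T) (hT1 : T ≤ 1) (m : ℕ) :
    Real.exp (-δ / T) ≤ m.factorial / δ ^ m * √T ^ m := by
  have h1 := Real.pow_div_factorial_le_exp (δ / T) (by positivity) m
  have h2 : T ^ m ≤ √T ^ m :=
    pow_le_pow_left₀ hT.le (Real.le_sqrt_of_sq_le (by nlinarith)) m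
  have h3 : 0 < (m.factorial : ℝ) := by positivity
  rw [neg_div, Real.exp_neg]
  calc _ ≤ ((δ / T) ^ m / m.factorial)⁻¹ := inv_anti₀ (by positivity) h1
    _ = m.factorial / δ ^ m * T ^ m := by
        rw [inv_div, div_pow]
        field_simp
    _ ≤ _ := by gcongr

/-- The weight at `T` splits into a factor of order `exp (-δ / T)` and the weight at temperature
`1`, so `s` may be unbounded. -/
theorem gibbsBound_of_le {g : E → F} {δ : ℝ} (hδ : 0 < δ) {s : Set E} (hs : MeasurableSet s)
    (hle : ∀ y ∈ s, δ ≤ ‖g y‖ ^ 2) (hfin : gibbsMass g 1 s ≠ ⊤) (m : ℕ) : GibbsBound g m s := by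
  refine ⟨ENNReal.ofReal (Real.exp δ * (m.factorial / δ ^ m)) * gibbsMass g 1 s,
    ENNReal.mul_ne_top ENNReal.ofReal_ne_top hfin, fun T hT hT1 => ?_⟩
  calc gibbsMass g T s
      ≤ ∫⁻ y in s, ENNReal.ofReal (Real.exp δ * (m.factorial / δ ^ m) * √T ^ m) *
          ENNReal.ofReal (Real.exp (-‖g y‖ ^ 2 / 1)) := by
        refine setLIntegral_mono' hs fun y hy => ?_
        rw [← ENNReal.ofReal_mul (by positivity)]
        refine ENNReal.ofReal_le_ofReal ?_
        have h1 : -‖g y‖ ^ 2 / T ≤ δ + -δ / T + -‖g y‖ ^ 2 / 1 := by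
          have h2 := hle y hy
          have h3 : 0 ≤ (‖g y‖ ^ 2 - δ) * (1 / T - 1) :=
            mul_nonneg (by linarith) (by rw [sub_nonneg, le_div_iff₀ hT]; linarith)
          have h4 : (‖g y‖ ^ 2 - δ) * (1 / T - 1) =
            δ + -δ / T + -‖g y‖ ^ 2 / 1 - -‖g y‖ ^ 2 / T := by field_simp; ring
          linarith
        refine (Real.exp_le_exp.2 h1).trans ?_
        rw [Real.exp_add, Real.exp_add, mul_assoc (Real.exp δ) (_ / _)]
        exact mul_le_mul_of_nonneg_right (mul_le_mul_of_nonneg_left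
          (exp_neg_div_le_sqrt_pow hδ hT hT1 m) (Real.exp_pos _).le) (Real.exp_pos _).le
    _ = ENNReal.ofReal (Real.exp δ * (m.factorial / δ ^ m) * √T ^ m) * gibbsMass g 1 s :=
        lintegral_const_mul' _ _ ENNReal.ofReal_ne_top
    _ = _ := by
        rw [ENNReal.ofReal_mul (by positivity)]
        ring

theorem integrable_exp_neg_norm_sq_div {g : E → F} (hg : Continuous g) {c C : ℝ} (hc : 0 < c)
    (hgrow : ∀ y, c * ‖y‖ ^ 2 - C ≤ ‖g y‖ ^ 2) {T : ℝ} (hT : 0 < T) :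
    Integrable fun y => Real.exp (-‖g y‖ ^ 2 / T) := by
  refine ((integrable_exp_neg_mul_sq_norm (E := E) (div_pos hc hT)).const_mul
    (Real.exp (C / T))).mono' (by fun_prop) (ae_of_all _ fun y => ?_)
  rw [Real.norm_eq_abs, Real.abs_exp, ← Real.exp_add, Real.exp_le_exp]
  have h := div_le_div_of_nonneg_right (hgrow y) hT.le
  have : C / T + -(c / T) * ‖y‖ ^ 2 = -((c * ‖y‖ ^ 2 - C) / T) := by ring
  rw [this, neg_div]
  linarith

theorem gibbsBound_univ [NormedSpace ℝ F] [FiniteDimensional ℝ F] {g : E → F}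
    (hg : ContDiff ℝ 1 g) {c C : ℝ} (hc : 0 < c) (hgrow : ∀ y, c * ‖y‖ ^ 2 - C ≤ ‖g y‖ ^ 2) {m : ℕ}
    (hm : ∀ x, g x = 0 → m ≤ Module.finrank ℝ (LinearMap.range (fderiv ℝ g x : E →ₗ[ℝ] F))) :
    GibbsBound g m Set.univ := by
  have hfin : ∀ s, gibbsMass g 1 s ≠ ⊤ := fun s =>
    (((integrable_exp_neg_norm_sq_div hg.continuous hc hgrow one_pos).integrableOn
      (s := s)).lintegral_lt_top).ne
  have hcont : Continuous fun y => ‖g y‖ ^ 2 := by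
    have := hg.continuous
    fun_prop
  -- This radius forces `‖g y‖² ≥ 1` outside the ball.
  have hball : GibbsBound g m (Metric.closedBall 0 (√((1 + C) / c))) := by
    refine IsCompact.induction_on (isCompact_closedBall _ _) ?_ (fun s t => GibbsBound.mono)
      (fun s t => GibbsBound.union) fun x _ => ?_
    · exact ⟨0, by simp, by simp [gibbsMass]⟩
    · by_cases hx : g x = 0
      · obtain ⟨U, hU, h⟩ := exists_mem_nhds_gibbsBound hg x (hm x hx)
        exact ⟨U, mem_nhdsWithin_of_mem_nhds hU, h⟩
      · have hpos : 0 < ‖g x‖ ^ 2 := by positivity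
        refine ⟨{y | ‖g x‖ ^ 2 / 2 < ‖g y‖ ^ 2}, mem_nhdsWithin_of_mem_nhds
          ((isOpen_lt continuous_const hcont).mem_nhds (by simpa using hpos)),
          gibbsBound_of_le (half_pos hpos) (isOpen_lt continuous_const hcont).measurableSet
            (fun y hy => le_of_lt hy) (hfin _) m⟩
  have hcompl : GibbsBound g m (Metric.closedBall 0 (√((1 + C) / c)))ᶜ := by
    refine gibbsBound_of_le one_pos Metric.isClosed_closedBall.measurableSet.compl
      (fun y hy => ?_) (hfin _) m
    rw [Set.mem_compl_iff, mem_closedBall_zero_iff, not_le] at hy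
    have h := (div_lt_iff₀ hc).1 (Real.lt_sq_of_sqrt_lt hy)
    linarith [hgrow y]
  simpa using hball.union hcompl

/-- `Φ` carries the nearby zeros into a bounded part of the kernel, whose dimension is at most `d`,
and its inverse is Lipschitz. -/
theorem exists_mem_nhds_hausdorffMeasure_lt_top [NormedSpace ℝ F] [FiniteDimensional ℝ F]
    {g : E → F} (hg : ContDiff ℝ 1 g) (x : E) {d : ℕ}
    (hd : Module.finrank ℝ E ≤
      Module.finrank ℝ (LinearMap.range (fderiv ℝ g x : E →ₗ[ℝ] F)) + d) :
    ∃ U ∈ 𝓝 x, Measure.euclideanHausdorffMeasure d (U ∩ {y | g y = 0}) < ⊤ := by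
  obtain ⟨Φ, hΦ, c, hc, U, hU, hUo, hmaps, hdist, -, hker⟩ := exists_local_coordinates hg x
  set W := (fderiv ℝ g x).ker with hW
  have hrank : Module.finrank ℝ W ≤ d := by
    have h2 := LinearMap.finrank_range_add_finrank_ker (fderiv ℝ g x : E →ₗ[ℝ] F)
    change _ + Module.finrank ℝ W = _ at h2
    omega
  refine ⟨U, hU, (euclideanHausdorffMeasure_le_of_dist_le (f := Φ) (K := 2)
    (fun y hy z hz => hdist y hy.1 z hz.1) d).trans_lt (ENNReal.mul_lt_top (by simp) ?_)⟩
  have hsub : Φ '' (U ∩ {y | g y = 0}) ⊆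
      (Subtype.val : W → E) '' (Metric.ball (W.orthogonalProjectionOnto (Φ x)) 1) := by
    rintro _ ⟨y, hy, rfl⟩
    refine ⟨⟨Φ y, hker y hy.2⟩, ?_, rfl⟩
    have h1 : W.orthogonalProjectionOnto (Φ y) = ⟨Φ y, hker y hy.2⟩ :=
      W.orthogonalProjectionOnto_mem_subspace_eq_self ⟨Φ y, hker y hy.2⟩
    rw [← h1, mem_ball_iff_norm, ← map_sub]
    exact (W.norm_orthogonalProjectionOnto_apply_le _).trans_lt (mem_ball_iff_norm.1 (hmaps hy.1))
  refine (measure_mono hsub).trans_lt ?_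
  rw [isometry_subtype_coe.euclideanHausdorffMeasure_image]
  have htop : Measure.euclideanHausdorffMeasure (Module.finrank ℝ W)
      (Metric.ball (W.orthogonalProjectionOnto (Φ x)) 1) < ⊤ := by
    rw [InnerProductSpace.euclideanHausdorffMeasure_eq_volume]
    exact Metric.isBounded_ball.measure_lt_top
  rcases hrank.eq_or_lt with h | h
  · rwa [← h]
  -- If the kernel has dimension below `d`, finiteness of its own volume forces the `d`-measure to
  -- vanish.
  · rcases Measure.euclideanHausdorffMeasure_zero_or_top h
      (Metric.ball (W.orthogonalProjectionOnto (Φ x)) 1) with h0 | h0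
    · rw [h0]
      exact ENNReal.zero_lt_top
    · exact absurd h0 htop.ne

theorem hausdorffMeasure_zeros_lt_top [NormedSpace ℝ F] [FiniteDimensional ℝ F] {g : E → F}
    (hg : ContDiff ℝ 1 g) {c C : ℝ} (hc : 0 < c) (hgrow : ∀ y, c * ‖y‖ ^ 2 - C ≤ ‖g y‖ ^ 2) {d : ℕ}
    (hd : ∀ x, g x = 0 → Module.finrank ℝ E ≤
      Module.finrank ℝ (LinearMap.range (fderiv ℝ g x : E →ₗ[ℝ] F)) + d) :
    Measure.euclideanHausdorffMeasure d {y | g y = 0} < ⊤ := by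
  have hcomp : IsCompact {y | g y = 0} := by
    refine (isCompact_closedBall (0 : E) (√(C / c))).of_isClosed_subset
      (isClosed_eq hg.continuous continuous_const) fun y (hy : g y = 0) => ?_
    rw [mem_closedBall_zero_iff]
    refine Real.le_sqrt_of_sq_le ?_
    have := hgrow y
    rw [hy, norm_zero] at this
    rw [le_div_iff₀ hc]
    linarith
  refine hcomp.measure_lt_top_of_nhdsWithin fun x hx => ?_
  obtain ⟨U, hU, h⟩ := exists_mem_nhds_hausdorffMeasure_lt_top hg x (hd x hx)
  refine ⟨U ∩ {y | g y = 0}, ?_, h⟩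
  exact inter_mem (mem_nhdsWithin_of_mem_nhds hU) self_mem_nhdsWithin

end Laplace

/-! ### Lower bounds from a submanifold chart -/

section LowerBounds

theorem image_symm_image_of_subset_target {X Y : Type*} [TopologicalSpace X] [TopologicalSpace Y]
    {φ : OpenPartialHomeomorph X Y} {s : Set Y} (hs : s ⊆ φ.target) : φ '' (φ.symm '' s) = s := by
  rw [← Set.image_comp]
  exact (Set.EqOn.image_eq fun z hz => φ.right_inv (hs hz)).trans (Set.image_id s)

variable {E : Type*} [NormedAddCommGroup E] [InnerProductSpace ℝ E]

theorem exists_lipschitzOnWith_chart {φ : OpenPartialHomeomorph E E} {x : E} (hx : x ∈ φ.source)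
    (hφ : ContDiffOn ℝ ∞ φ φ.source) :
    ∃ K : NNReal, ∃ ε > 0, Metric.ball (φ x) ε ⊆ φ.target ∧
      LipschitzOnWith K φ (φ.symm '' Metric.ball (φ x) ε) := by
  have h1 : ContDiffAt ℝ 1 φ x :=
    (hφ.contDiffAt (φ.open_source.mem_nhds hx)).of_le (by exact_mod_cast le_top)
  obtain ⟨K, t, ht, hK⟩ := h1.exists_lipschitzOnWith
  have h2 : φ.symm ⁻¹' t ∈ 𝓝 (φ x) :=
    (φ.continuousAt_symm (φ.map_source hx)).preimage_mem_nhds (by rwa [φ.left_inv hx])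
  obtain ⟨ε, hε, hsub⟩ :=
    Metric.mem_nhds_iff.1 (inter_mem (φ.open_target.mem_nhds (φ.map_source hx)) h2)
  exact ⟨K, ε, hε, fun z hz => (hsub hz).1,
    hK.mono (Set.image_subset_iff.2 fun z hz => (hsub hz).2)⟩

variable [FiniteDimensional ℝ E] [MeasurableSpace E] [BorelSpace E]

/-- The chart maps a piece of `S` by a Lipschitz map onto a ball of `W`, so that piece cannot be
null. -/
theorem IsSmoothSubmanifoldAt.hausdorffMeasure_pos {S : Set E} {k : ℕ} {x : E}
    (h : IsSmoothSubmanifoldAt S k x) : 0 < Measure.euclideanHausdorffMeasure k S := by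
  obtain ⟨hxS, φ, W, hx, hφ, -, hW, himg⟩ := h
  obtain ⟨K, ε, hε, hball, hK⟩ := exists_lipschitzOnWith_chart hx hφ
  have hx0 : φ x ∈ W := (himg.subset ⟨x, ⟨hx, hxS⟩, rfl⟩).2
  have hsub : φ.symm '' (Metric.ball (φ x) ε ∩ W) ⊆ S := by
    rintro _ ⟨z, ⟨hz, hzW⟩, rfl⟩
    obtain ⟨y, ⟨hy, hyS⟩, rfl⟩ := himg.symm.subset ⟨hball hz, hzW⟩
    rwa [φ.left_inv hy]
  have h1 := euclideanHausdorffMeasure_image_le_of_lipschitzOnWith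
    (hK.mono (Set.image_mono Set.inter_subset_left : φ.symm '' (Metric.ball (φ x) ε ∩ W) ⊆ _)) k
  rw [image_symm_image_of_subset_target (Set.inter_subset_left.trans hball)] at h1
  have h2 : Metric.ball (φ x) ε ∩ W = (Subtype.val : W → E) '' Metric.ball ⟨φ x, hx0⟩ ε := by
    ext z
    constructor
    · exact fun hz => ⟨⟨z, hz.2⟩, hz.1, rfl⟩
    · rintro ⟨u, hu, rfl⟩
      exact ⟨hu, u.2⟩
  rw [h2, isometry_subtype_coe.euclideanHausdorffMeasure_image, ← h2, ← hW,
    InnerProductSpace.euclideanHausdorffMeasure_eq_volume] at h1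
  have h3 : 0 < volume (Metric.ball (⟨φ x, hx0⟩ : W) ε) := Metric.measure_ball_pos _ _ hε
  rw [hW] at h1
  refine pos_iff_ne_zero.2 fun h0 => ?_
  rw [measure_mono_null hsub h0, mul_zero] at h1
  exact h3.not_ge h1

variable {F : Type*} [NormedAddCommGroup F]

theorem le_gibbsMass_of_volume_le {g : E → F} (hg : Continuous g) {T q : ℝ} {D : Set E}
    (hD : ∀ y ∈ D, ‖g y‖ ^ 2 / T ≤ q) :
    ENNReal.ofReal (Real.exp (-q)) * volume D ≤ gibbsMass g T Set.univ := by
  rw [gibbsMass, Measure.restrict_univ]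
  have hcont : Continuous fun y => ENNReal.ofReal (Real.exp (-‖g y‖ ^ 2 / T)) :=
    ENNReal.continuous_ofReal.comp (by fun_prop)
  refine le_trans ?_ (mul_meas_ge_le_lintegral hcont.measurable (ENNReal.ofReal (Real.exp (-q))))
  gcongr
  intro y hy
  refine ENNReal.ofReal_le_ofReal (Real.exp_le_exp.2 ?_)
  rw [neg_div, neg_le_neg_iff]
  exact hD y hy

/-- `g ∘ φ.symm` is locally Lipschitz and vanishes on `W`, hence is `O(√T)` at distance `O(√T)` from
`W`. No rank condition enters. -/
theorem IsSmoothSubmanifoldAt.exists_le_gibbsMass [NormedSpace ℝ F] {g : E → F}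
    (hg : ContDiff ℝ 1 g) {S : Set E} (hS : ∀ y ∈ S, g y = 0) {k : ℕ} {x : E}
    (h : IsSmoothSubmanifoldAt S k x) :
    ∃ c : ENNReal, c ≠ 0 ∧ ∀ T : ℝ, 0 < T → T ≤ 1 →
      c * ENNReal.ofReal (√T ^ (Module.finrank ℝ E - k)) ≤ gibbsMass g T Set.univ := by
  obtain ⟨hxS, φ, W, hx, hφ, hψ, hW, himg⟩ := h
  obtain ⟨K, ε₁, hε₁, hball, hK⟩ := exists_lipschitzOnWith_chart hx hφ
  have hx0 : φ x ∈ W := (himg.subset ⟨x, ⟨hx, hxS⟩, rfl⟩).2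
  have h1 : ContDiffAt ℝ 1 (g ∘ φ.symm) (φ x) := hg.contDiffAt.comp _
    ((hψ.contDiffAt (φ.open_target.mem_nhds (φ.map_source hx))).of_le (by exact_mod_cast le_top))
  obtain ⟨L, t, ht, hL⟩ := h1.exists_lipschitzOnWith
  obtain ⟨ε, hε, hsub⟩ := Metric.mem_nhds_iff.1 (inter_mem (Metric.ball_mem_nhds (φ x) hε₁) ht)
  have hrank : Module.finrank ℝ Wᗮ = Module.finrank ℝ E - k := by
    have := W.finrank_add_finrank_orthogonal
    omega
  have hv1 : 0 < volume (Metric.ball (0 : W) (ε / 2)) :=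
    Metric.measure_ball_pos _ _ (half_pos hε)
  have hv2 : 0 < volume (Metric.ball (0 : Wᗮ) (ε / 2)) :=
    Metric.measure_ball_pos _ _ (half_pos hε)
  set n := Module.finrank ℝ E with hn
  set q : ℝ := (L * (ε / 2)) ^ 2 with hq
  -- The added `1` keeps the divisor away from `0` and only weakens the bound.
  refine ⟨ENNReal.ofReal (Real.exp (-q)) * (((K : ENNReal) ^ n + 1)⁻¹ *
    (volume (Metric.ball (0 : W) (ε / 2)) * volume (Metric.ball (0 : Wᗮ) (ε / 2)))), ?_,
    fun T hT hT1 => ?_⟩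
  · refine mul_ne_zero (ENNReal.ofReal_pos.2 (Real.exp_pos _)).ne'
      (mul_ne_zero (ENNReal.inv_ne_zero.2 (by simp)) (mul_ne_zero hv1.ne' hv2.ne'))
  have hsT : 0 < √T := Real.sqrt_pos.2 hT
  set B : Set E := {z : E | ‖W.orthogonalProjectionOnto (z - φ x)‖ < ε / 2 ∧
        ‖Wᗮ.orthogonalProjectionOnto (z - φ x)‖ < ε / 2 * √T} with hB
  have hvB := volume_orthogonal_box W (φ x) (r := ε / 2) hsT
  have hBball : B ⊆ Metric.ball (φ x) ε := by
    intro z hz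
    have hT2 : √T ≤ 1 := Real.sqrt_le_one.2 hT1
    have h2 : ε / 2 * √T ≤ ε / 2 := mul_le_of_le_one_right (by positivity) hT2
    rw [mem_ball_iff_norm, ← orthogonalProjectionOnto_add_orthogonal W (z - φ x)]
    refine (norm_add_le _ _).trans_lt ?_
    have h3 := hz.1
    have h4 := hz.2
    rw [Submodule.norm_coe, Submodule.norm_coe]
    linarith
  have hDB : φ '' (φ.symm '' B) = B :=
    image_symm_image_of_subset_target (hBball.trans fun z hz => hball (hsub hz).1)
  have hvD := volume_image_le_of_lipschitzOnWith
    (hK.mono (Set.image_mono (hBball.trans fun z hz => (hsub hz).1) : φ.symm '' B ⊆ _))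
  rw [hDB] at hvD
  have hgD : ∀ y ∈ φ.symm '' B, ‖g y‖ ^ 2 / T ≤ q := by
    rintro _ ⟨z, hz, rfl⟩
    -- As `φ x ∈ W`, the foot `w` of `z` on `W` stays in the ball, where it represents a zero of
    -- `g`.
    set w : E := (W.orthogonalProjectionOnto z : E) with hw
    have hxW : (W.orthogonalProjectionOnto (φ x) : E) = φ x :=
      congrArg Subtype.val (W.orthogonalProjectionOnto_mem_subspace_eq_self ⟨φ x, hx0⟩)
    have hxW' : Wᗮ.orthogonalProjectionOnto (φ x) = 0 :=
      Submodule.orthogonalProjectionOnto_orthogonal_apply_eq_zero hx0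
    have hwball : w ∈ Metric.ball (φ x) ε := by
      rw [mem_ball_iff_norm, hw, ← hxW, ← Submodule.coe_sub, ← map_sub, Submodule.norm_coe]
      linarith [hz.1]
    have hgw : g (φ.symm w) = 0 := by
      obtain ⟨y, ⟨hy, hyS⟩, hyw⟩ := himg.symm.subset
        ⟨hball (hsub hwball).1, (W.orthogonalProjectionOnto z).2⟩
      rw [← hyw, φ.left_inv hy]
      exact hS y hyS
    have h2 := hL.dist_le_mul z (hsub (hBball hz)).2 w (hsub hwball).2
    have h3 : ‖z - w‖ < ε / 2 * √T := by
      have h4 := hz.2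
      rw [map_sub, hxW', sub_zero] at h4
      rwa [hw, sub_eq_of_eq_add' (orthogonalProjectionOnto_add_orthogonal W z).symm]
    simp only [Function.comp_apply, hgw, dist_eq_norm, sub_zero] at h2
    rw [div_le_iff₀ hT]
    calc ‖g (φ.symm z)‖ ^ 2 ≤ (L * (ε / 2 * √T)) ^ 2 := by
          gcongr
          exact h2.trans (mul_le_mul_of_nonneg_left h3.le L.coe_nonneg)
      _ = q * T := by rw [← mul_assoc, mul_pow, Real.sq_sqrt hT.le]
  refine le_trans ?_ (le_gibbsMass_of_volume_le hg.continuous hgD)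
  rw [mul_assoc]
  gcongr
  rw [mul_assoc, ← ENNReal.div_eq_inv_mul]
  refine ENNReal.div_le_of_le_mul' ?_
  calc _ = volume B := by
        rw [hvB, hrank]
        ring
    _ ≤ _ := hvD
    _ ≤ _ := by
        gcongr
        exact le_self_add

end LowerBounds

/-- The chart is translation by `-x`, restricted to an open `V` meeting `S` only in `x`, with `W =
⊥`. -/
theorem isSmoothSubmanifoldAt_zero_of_isolated {E : Type*} [NormedAddCommGroup E]
    [NormedSpace ℝ E] {S : Set E} {x : E} (hx : x ∈ S) {U : Set E} (hU : U ∈ 𝓝 x)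
    (h : S ∩ U = {x}) : IsSmoothSubmanifoldAt S 0 x := by
  obtain ⟨V, hVU, hV, hxV⟩ := mem_nhds_iff.1 hU
  refine ⟨hx, (Homeomorph.subRight x).toOpenPartialHomeomorph.restrOpen V hV, ⊥, ?_, ?_, ?_,
    finrank_bot ℝ E, ?_⟩
  · simpa using hxV
  · exact (contDiff_id.sub contDiff_const).contDiffOn
  · exact (contDiff_id.add contDiff_const).contDiffOn
  · ext z
    have hS : ∀ y, y ∈ V → y ∈ S → y = x := fun y hy hyS => h.subset ⟨hyS, hVU hy⟩
    constructor
    · rintro ⟨y, ⟨hy, hyS⟩, rfl⟩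
      refine ⟨OpenPartialHomeomorph.map_source _ hy, ?_⟩
      have : y = x := hS y (by simpa using hy) hyS
      simp [this]
    · rintro ⟨-, hz⟩
      obtain rfl : z = 0 := by simpa using hz
      exact ⟨x, ⟨by simpa using hxV, hx⟩, by simp⟩

/-! ### Smoothness and growth of the polynomial -/

section Polynomial

variable {A : Type*} [MulNormedNonAssocRing A] [InnerProductSpace ℝ A]
  [IsScalarTower ℝ A A] [SMulCommClass ℝ A A]

theorem isBoundedBilinearMap_mul :
    IsBoundedBilinearMap ℝ fun p : A × A => p.1 * p.2 where
  add_left := add_mul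
  smul_left := smul_mul_assoc
  add_right := mul_add
  smul_right c x y := mul_smul_comm c x y
  bound := ⟨1, one_pos, fun x y => by rw [MulNormedNonAssocRing.norm_mul, one_mul]⟩

theorem contDiff_pow (k : ℕ) {n : WithTop ℕ∞} : ContDiff ℝ n fun x : A => pow x k := by
  induction k with
  | zero => exact contDiff_const
  | succ k ih => exact isBoundedBilinearMap_mul.contDiff.comp (ih.prodMk contDiff_id)

theorem contDiff_eval (P : ℕ →₀ A) {n : WithTop ℕ∞} : ContDiff ℝ n (eval P) :=
  ContDiff.sum fun k _ => isBoundedBilinearMap_mul.contDiff.comp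
    (contDiff_const.prodMk (contDiff_pow k))

theorem continuous_potential (P : ℕ →₀ A) : Continuous (potential P) := by
  have := (contDiff_eval P (n := 0)).continuous
  unfold potential
  fun_prop

end Polynomial

section Growth

variable {A : Type*} [MulNormedNonAssocRing A]

theorem norm_pow_eq [Nontrivial A] (x : A) (k : ℕ) : ‖pow x k‖ = ‖x‖ ^ k := by
  induction k with
  | zero =>
    have h := MulNormedNonAssocRing.norm_mul (1 : A) 1
    rw [mul_one] at h
    have h1 : ‖(1 : A)‖ ≠ 0 := norm_ne_zero_iff.2 one_ne_zero
    rw [pow_zero]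
    exact (mul_left_cancel₀ h1 (by rw [mul_one]; exact h)).symm
  | succ k ih => rw [pow_succ, ← ih]; exact MulNormedNonAssocRing.norm_mul _ _

/-- For `‖y‖ > 1` multiplicativity of the norm gives the leading term exact size `‖P n‖ ‖y‖ⁿ`, while
the others total at most `M ‖y‖ⁿ⁻¹`. -/
theorem exists_mul_norm_sub_le_norm_eval {P : ℕ →₀ A} (hP : ∃ k, 0 < k ∧ P k ≠ 0) :
    ∃ a D : ℝ, 0 < a ∧ ∀ y, a * ‖y‖ - D ≤ ‖eval P y‖ := by
  obtain ⟨k₀, hk₀, hPk₀⟩ := hP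
  have : Nontrivial A := ⟨⟨P k₀, 0, hPk₀⟩⟩
  have hne : P.support.Nonempty := ⟨k₀, Finsupp.mem_support_iff.2 hPk₀⟩
  set n := P.support.max' hne with hn
  have hnmem : n ∈ P.support := P.support.max'_mem hne
  have hn0 : 0 < n := hk₀.trans_le (P.support.le_max' k₀ (Finsupp.mem_support_iff.2 hPk₀))
  have ha : 0 < ‖P n‖ := norm_pos_iff.2 (Finsupp.mem_support_iff.1 hnmem)
  set M := ∑ k ∈ P.support.erase n, ‖P k‖ with hM
  have hM0 : 0 ≤ M := Finset.sum_nonneg fun _ _ => norm_nonneg _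
  -- With this `D` the left side is nonpositive when `‖y‖ ≤ 1` or `‖P n‖ ‖y‖ ≤ M`.
  refine ⟨‖P n‖, M + ‖P n‖, ha, fun y => ?_⟩
  rcases le_or_gt ‖y‖ 1 with hy | hy
  · have := norm_nonneg (eval P y)
    nlinarith
  have hsplit : eval P y = P n * pow y n + ∑ k ∈ P.support.erase n, P k * pow y k :=
    (Finset.add_sum_erase _ (fun k => P k * pow y k) hnmem).symm
  have hrest : ‖∑ k ∈ P.support.erase n, P k * pow y k‖ ≤ M * ‖y‖ ^ (n - 1) := by
    rw [hM, Finset.sum_mul]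
    refine norm_sum_le_of_le _ fun k hk => ?_
    rw [MulNormedNonAssocRing.norm_mul, norm_pow_eq]
    have hkn : k < n := lt_of_le_of_ne (P.support.le_max' k (Finset.mem_of_mem_erase hk))
      (Finset.ne_of_mem_erase hk)
    have : ‖y‖ ^ k ≤ ‖y‖ ^ (n - 1) := pow_le_pow_right₀ hy.le (by omega)
    gcongr
  have hlead : ‖P n * pow y n‖ = ‖P n‖ * ‖y‖ * ‖y‖ ^ (n - 1) := by
    rw [MulNormedNonAssocRing.norm_mul, norm_pow_eq, mul_assoc, ← pow_succ',
      Nat.sub_add_cancel hn0]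
  have htri : ‖P n‖ * ‖y‖ * ‖y‖ ^ (n - 1) - M * ‖y‖ ^ (n - 1) ≤ ‖eval P y‖ := by
    have := norm_sub_le (eval P y) (∑ k ∈ P.support.erase n, P k * pow y k)
    rw [hsplit, add_sub_cancel_right, hlead, ← hsplit] at this
    linarith
  have h1 : 1 ≤ ‖y‖ ^ (n - 1) := one_le_pow₀ hy.le
  rcases le_or_gt (‖P n‖ * ‖y‖) M with h | h
  · have := norm_nonneg (eval P y)
    linarith
  · nlinarith

theorem exists_mul_norm_sq_sub_le {P : ℕ →₀ A} (hP : ∃ k, 0 < k ∧ P k ≠ 0) :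
    ∃ c C : ℝ, 0 < c ∧ ∀ y, c * ‖y‖ ^ 2 - C ≤ ‖eval P y‖ ^ 2 := by
  obtain ⟨a, D, ha, h⟩ := exists_mul_norm_sub_le_norm_eval hP
  refine ⟨a ^ 2 / 2, D ^ 2, by positivity, fun y => ?_⟩
  have h1 : a * ‖y‖ ≤ ‖eval P y‖ + |D| := by linarith [h y, le_abs_self D]
  have h2 : (a * ‖y‖) ^ 2 ≤ (‖eval P y‖ + |D|) ^ 2 := pow_le_pow_left₀ (by positivity) h1 2
  nlinarith [sq_nonneg (‖eval P y‖ - |D|), sq_abs D]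

theorem potential_nonneg (P : ℕ →₀ A) (x : A) : 0 ≤ potential P x := sq_nonneg _

end Growth

/-! ### Consequences of the Morse–Bott condition -/

section MorseBott

variable {A : Type*} [MulNormedNonAssocRing A] [InnerProductSpace ℝ A] {P : ℕ →₀ A}

theorem HasIsolatedMorseRoots.isMorseBottRootManifold (h : HasIsolatedMorseRoots P) :
    IsMorseBottRootManifold P 0 := by
  have hsub : ∀ x ∈ rootSet P, IsSmoothSubmanifoldAt (rootSet P) 0 x := fun x hx => by
    obtain ⟨U, hU, hUx⟩ := h.isolated x hx
    exact isSmoothSubmanifoldAt_zero_of_isolated hx hU hUx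
  obtain ⟨x, hx⟩ := h.nonempty
  exact ⟨fun y hy => ⟨0, le_rfl, hsub y hy, h.nondegenerate y hy⟩, x, hsub x hx⟩

theorem IsMorseBottRootManifold.finrank_le_rank_add {d : ℕ} (h : IsMorseBottRootManifold P d)
    (x : A) (hx : eval P x = 0) : Module.finrank ℝ A ≤
      Module.finrank ℝ (LinearMap.range (fderiv ℝ (eval P) x : A →ₗ[ℝ] A)) + d := by
  obtain ⟨k, hk, -, hrank⟩ := h.nondegenerate x hx
  rw [jacobianRank] at hrank
  omega

theorem IsMorseBottRootManifold.le_finrank [FiniteDimensional ℝ A] {d : ℕ}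
    (h : IsMorseBottRootManifold P d) :
    d ≤ Module.finrank ℝ A := by
  obtain ⟨x, -, φ, W, -, -, -, hW, -⟩ := h.dim_attained
  exact hW ▸ W.finrank_le

theorem IsMorseBottRootManifold.rootVolume_pos [FiniteDimensional ℝ A]
    [MeasurableSpace A] [BorelSpace A] {d : ℕ} (h : IsMorseBottRootManifold P d) :
    0 < rootVolume P d := by
  obtain ⟨x, hx⟩ := h.dim_attained
  exact hx.hausdorffMeasure_pos

end MorseBott

/-- Trades the energy factor for a doubled temperature, both to dominate `Z'` and to bound the mean
energy by `Z(2T)`. -/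
theorem mul_exp_neg_le {t : ℝ} : t * Real.exp (-t) ≤ 2 * Real.exp (-(t / 2)) := by
  have h1 := Real.add_one_le_exp (t / 2)
  have h2 : Real.exp (-(t / 2)) = Real.exp (t / 2) * Real.exp (-t) := by
    rw [← Real.exp_add]
    congr 1
    ring
  rw [h2, ← mul_assoc]
  exact mul_le_mul_of_nonneg_right (by linarith) (Real.exp_pos _).le

/-! ### Partition function, free energy and entropy -/

section Thermodynamics

variable {A : Type*} [MulNormedNonAssocRing A] [InnerProductSpace ℝ A] [FiniteDimensional ℝ A]
  [IsScalarTower ℝ A A] [SMulCommClass ℝ A A] [MeasurableSpace A] [BorelSpace A] {P : ℕ →₀ A}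

theorem integrable_exp_neg_potential (hP : ∃ k, 0 < k ∧ P k ≠ 0) {T : ℝ} (hT : 0 < T) :
    Integrable fun x => Real.exp (-potential P x / T) := by
  obtain ⟨c, C, hc, h⟩ := exists_mul_norm_sq_sub_le hP
  exact integrable_exp_neg_norm_sq_div (contDiff_eval P (n := 0)).continuous hc h hT

theorem partitionFunction_pos (hP : ∃ k, 0 < k ∧ P k ≠ 0) {T : ℝ} (hT : 0 < T) :
    0 < partitionFunction P T :=
  integral_exp_pos (integrable_exp_neg_potential hP hT)

theorem ofReal_partitionFunction (hP : ∃ k, 0 < k ∧ P k ≠ 0) {T : ℝ} (hT : 0 < T) :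
    ENNReal.ofReal (partitionFunction P T) = gibbsMass (eval P) T Set.univ := by
  rw [partitionFunction, ofReal_integral_eq_lintegral_ofReal (integrable_exp_neg_potential hP hT)
    (ae_of_all _ fun _ => (Real.exp_pos _).le), gibbsMass, Measure.restrict_univ]
  rfl

theorem isProbabilityMeasure_gibbsMeasure (hP : ∃ k, 0 < k ∧ P k ≠ 0) {T : ℝ} (hT : 0 < T) :
    IsProbabilityMeasure (gibbsMeasure P T) := by
  have hZ := partitionFunction_pos hP hT
  constructor
  rw [gibbsMeasure, withDensity_apply _ MeasurableSet.univ, Measure.restrict_univ,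
    ← ofReal_integral_eq_lintegral_ofReal ((integrable_exp_neg_potential hP hT).const_mul _)
      (ae_of_all _ fun _ => by positivity), integral_const_mul]
  change ENNReal.ofReal ((partitionFunction P T)⁻¹ * partitionFunction P T) = 1
  rw [inv_mul_cancel₀ hZ.ne', ENNReal.ofReal_one]

theorem hasDerivAt_partitionFunction (hP : ∃ k, 0 < k ∧ P k ≠ 0) {T : ℝ} (hT : 0 < T) :
    HasDerivAt (partitionFunction P)
      (∫ x, potential P x / T ^ 2 * Real.exp (-potential P x / T)) T := by
  have hcont := continuous_potential P
  refine (hasDerivAt_integral_of_dominated_loc_of_deriv_le (μ := volume) (𝕜 := ℝ)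
    (F := fun T x => Real.exp (-potential P x / T))
    (F' := fun T x => potential P x / T ^ 2 * Real.exp (-potential P x / T))
    -- For `T/2 < s < 2T`, `mul_exp_neg_le` gives `(2/s) exp (-‖P‖² / (2s))`, and then `2/s ≤ 4/T`
    -- and `2s ≤ 4T`.
    (bound := fun x => 4 / T * Real.exp (-potential P x / (4 * T)))
    (s := Set.Ioo (T / 2) (2 * T)) (Ioo_mem_nhds (by linarith) (by linarith))
    (Eventually.of_forall fun s => by fun_prop) (integrable_exp_neg_potential hP hT)
    (by fun_prop) (ae_of_all _ fun x s hs => ?_)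
    ((integrable_exp_neg_potential hP (by positivity)).const_mul _)
    (ae_of_all _ fun x s hs => ?_)).2
  · have hf := potential_nonneg P x
    have hs0 : 0 < s := by linarith [hs.1]
    rw [Real.norm_eq_abs, abs_of_nonneg (by positivity)]
    calc potential P x / s ^ 2 * Real.exp (-potential P x / s)
        = 1 / s * (potential P x / s * Real.exp (-(potential P x / s))) := by
          rw [neg_div]
          field_simp
      _ ≤ 1 / s * (2 * Real.exp (-(potential P x / s / 2))) := by
          exact mul_le_mul_of_nonneg_left mul_exp_neg_le (by positivity)
      _ = 2 / s * Real.exp (-potential P x / (2 * s)) := by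
          rw [neg_div, div_div, mul_comm s 2]
          ring
      _ ≤ 4 / T * Real.exp (-potential P x / (4 * T)) := by
          have h1 : 2 / s ≤ 4 / T := by
            rw [div_le_div_iff₀ hs0 hT]
            linarith [hs.1]
          have h2 : potential P x / (4 * T) ≤ potential P x / (2 * s) := by
            exact div_le_div_of_nonneg_left hf (by positivity) (by linarith [hs.2])
          refine mul_le_mul h1 (Real.exp_le_exp.2 ?_) (Real.exp_pos _).le (by positivity)
          rw [neg_div, neg_div]
          linarith
  · have hs0 : s ≠ 0 := by linarith [hs.1]
    refine ((hasDerivAt_inv hs0).const_mul (-potential P x)).exp.congr_deriv ?_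
    rw [← div_eq_mul_inv]
    ring

theorem hasDerivAt_freeEnergy (hP : ∃ k, 0 < k ∧ P k ≠ 0) {T : ℝ} (hT : 0 < T) :
    HasDerivAt (freeEnergy P) (-(Real.log (partitionFunction P T) +
      (∫ x, potential P x / T * Real.exp (-potential P x / T)) / partitionFunction P T)) T := by
  have hZ := partitionFunction_pos hP hT
  have h := (hasDerivAt_id T).neg.mul ((hasDerivAt_partitionFunction hP hT).log hZ.ne')
  refine h.congr_deriv ?_
  have h1 : ∫ x, potential P x / T * Real.exp (-potential P x / T) =
      T * ∫ x, potential P x / T ^ 2 * Real.exp (-potential P x / T) := by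
    rw [← integral_const_mul]
    congr 1
    ext x
    field_simp
  rw [h1]
  simp only [Pi.neg_apply, id]
  ring

theorem exists_entropy_eq (hP : ∃ k, 0 < k ∧ P k ≠ 0) {T : ℝ} (hT : 0 < T) :
    ∃ u : ℝ, 0 ≤ u ∧ u ≤ 2 * partitionFunction P (2 * T) / partitionFunction P T ∧
      entropy P T = Real.log (partitionFunction P T) + u := by
  have hZ := partitionFunction_pos hP hT
  refine ⟨_, ?_, ?_, by rw [entropy, (hasDerivAt_freeEnergy hP hT).deriv, neg_neg]⟩
  · refine div_nonneg (integral_nonneg fun x => ?_) hZ.le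
    have := potential_nonneg P x
    positivity
  · gcongr
    rw [partitionFunction, ← integral_const_mul]
    refine integral_mono_of_nonneg (ae_of_all _ fun x => ?_)
      ((integrable_exp_neg_potential hP (by positivity)).const_mul _) (ae_of_all _ fun x => ?_)
    · have := potential_nonneg P x
      positivity
    · have := mul_exp_neg_le (t := potential P x / T)
      rwa [div_div, mul_comm T 2, ← neg_div, ← neg_div] at this

theorem IsMorseBottRootManifold.rootVolume_lt_top {d : ℕ} (h : IsMorseBottRootManifold P d)
    (hP : ∃ k, 0 < k ∧ P k ≠ 0) : rootVolume P d < ⊤ := by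
  obtain ⟨c, C, hc, hgrow⟩ := exists_mul_norm_sq_sub_le hP
  exact hausdorffMeasure_zeros_lt_top (contDiff_eval P) hc hgrow h.finrank_le_rank_add

theorem IsMorseBottRootManifold.exists_partitionFunction_bounds {d : ℕ}
    (h : IsMorseBottRootManifold P d) (hP : ∃ k, 0 < k ∧ P k ≠ 0) :
    ∃ c C : ℝ, 0 < c ∧ 0 < C ∧ ∀ T, 0 < T → T ≤ 1 →
      c * √T ^ (Module.finrank ℝ A - d) ≤ partitionFunction P T ∧
      partitionFunction P T ≤ C * √T ^ (Module.finrank ℝ A - d) := by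
  obtain ⟨c₀, C₀, hc₀, hgrow⟩ := exists_mul_norm_sq_sub_le hP
  obtain ⟨x, hx⟩ := h.dim_attained
  obtain ⟨c, hc, hlow⟩ := hx.exists_le_gibbsMass (contDiff_eval P) (fun y hy => hy)
  obtain ⟨C, hC, hup⟩ := gibbsBound_univ (contDiff_eval P) hc₀ hgrow
    (m := Module.finrank ℝ A - d) fun x hx => by
      have := h.finrank_le_rank_add x hx
      omega
  -- Comparing both bounds at `T = 1` shows that `c` is finite and `C` nonzero.
  have hcC : c ≤ C := by
    simpa using (hlow 1 one_pos le_rfl).trans (hup 1 one_pos le_rfl)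
  have hc' : c ≠ ⊤ := ne_top_of_le_ne_top hC hcC
  have hC0 : C ≠ 0 := fun h0 => hc (le_antisymm (h0 ▸ hcC) bot_le)
  refine ⟨c.toReal, C.toReal, ENNReal.toReal_pos hc hc', ENNReal.toReal_pos hC0 hC,
    fun T hT hT1 => ⟨?_, ?_⟩⟩
  · have h1 := hlow T hT hT1
    rw [← ofReal_partitionFunction hP hT, ← ENNReal.ofReal_toReal hc',
      ← ENNReal.ofReal_mul ENNReal.toReal_nonneg] at h1
    exact (ENNReal.ofReal_le_ofReal_iff (partitionFunction_pos hP hT).le).1 h1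
  · have h1 := hup T hT hT1
    rw [← ofReal_partitionFunction hP hT, ← ENNReal.ofReal_toReal hC,
      ← ENNReal.ofReal_mul ENNReal.toReal_nonneg] at h1
    exact (ENNReal.ofReal_le_ofReal_iff (by positivity)).1 h1

theorem IsMorseBottRootManifold.entropy_sub_isBigO {d : ℕ} (h : IsMorseBottRootManifold P d)
    (hP : ∃ k, 0 < k ∧ P k ≠ 0) :
    (fun T : ℝ => entropy P T - ((Module.finrank ℝ A : ℝ) - (d : ℝ)) / 2 * Real.log T)
      =O[𝓝[>] (0 : ℝ)] (fun _ : ℝ => (1 : ℝ)) := by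
  obtain ⟨c, C, hc, hC, hbd⟩ := h.exists_partitionFunction_bounds hP
  have hm : (Module.finrank ℝ A : ℝ) - d = ((Module.finrank ℝ A - d : ℕ) : ℝ) :=
    (Nat.cast_sub h.le_finrank).symm
  rw [hm]
  set m := Module.finrank ℝ A - d
  -- The logarithms come from the bounds on `log Z`; the last term bounds `2 Z(2T) / Z(T)`. Taking
  -- `T < 1/2` keeps `2T` in the range of the bounds.
  refine IsBigO.of_bound (|Real.log c| + |Real.log C| + 2 * C * √2 ^ m / c) ?_
  filter_upwards [Ioo_mem_nhdsGT (show (0 : ℝ) < 1 / 2 by norm_num)] with T hT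
  have hT0 : 0 < T := hT.1
  have hs : 0 < √T := Real.sqrt_pos.2 hT0
  obtain ⟨hlow, hup⟩ := hbd T hT0 (by linarith [hT.2])
  have hup2 := (hbd (2 * T) (by linarith) (by linarith [hT.2])).2
  obtain ⟨u, hu0, hu1, hS⟩ := exists_entropy_eq hP hT0
  have hZ := partitionFunction_pos hP hT0
  have hlog : ∀ b : ℝ, 0 < b → Real.log (b * √T ^ m) = Real.log b + m / 2 * Real.log T := by
    intro b hb
    rw [Real.log_mul hb.ne' (by positivity), Real.log_pow, Real.log_sqrt hT0.le]
    ring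
  have h1 := Real.log_le_log (by positivity) hlow
  have h2 := Real.log_le_log hZ hup
  rw [hlog c hc] at h1
  rw [hlog C hC] at h2
  have h3 : u ≤ 2 * C * √2 ^ m / c := by
    refine hu1.trans ?_
    rw [div_le_div_iff₀ hZ hc]
    rw [Real.sqrt_mul (by norm_num), mul_pow] at hup2
    calc 2 * partitionFunction P (2 * T) * c ≤ 2 * (C * (√2 ^ m * √T ^ m)) * c := by gcongr
      _ = 2 * C * √2 ^ m * (c * √T ^ m) := by ring
      _ ≤ _ := by gcongr
  rw [hS, norm_one, mul_one, Real.norm_eq_abs, abs_le]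
  have h4 := neg_abs_le (Real.log c)
  have h5 := le_abs_self (Real.log C)
  have h6 := abs_nonneg (Real.log c)
  have h7 := abs_nonneg (Real.log C)
  constructor <;> linarith

end Thermodynamics

end DivAlgPoly

theorem mainTheorem5 {A : Type*} [MulNormedNonAssocRing A] [InnerProductSpace ℝ A]
    [FiniteDimensional ℝ A] [IsScalarTower ℝ A A] [SMulCommClass ℝ A A]
    [MeasurableSpace A] [BorelSpace A]
    (P : ℕ →₀ A) (hP : ∃ k, 0 < k ∧ P k ≠ 0) :
    (∀ T : ℝ, 0 < T → IsProbabilityMeasure (DivAlgPoly.gibbsMeasure P T) ∧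
      DifferentiableAt ℝ (DivAlgPoly.freeEnergy P) T) ∧
    (∀ dM : ℕ, 0 < dM → DivAlgPoly.IsMorseBottRootManifold P dM →
      0 < DivAlgPoly.rootVolume P dM ∧ DivAlgPoly.rootVolume P dM < ⊤ ∧
      (fun T : ℝ => DivAlgPoly.entropy P T -
          (((Module.finrank ℝ A : ℝ) - (dM : ℝ)) / 2 * Real.log T +
            Real.log (DivAlgPoly.rootVolume P dM).toReal))
        =O[𝓝[>] (0 : ℝ)] (fun _ : ℝ => (1 : ℝ))) ∧
    (DivAlgPoly.HasIsolatedMorseRoots P →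
      (fun T : ℝ => DivAlgPoly.entropy P T - (Module.finrank ℝ A : ℝ) / 2 * Real.log T)
        =O[𝓝[>] (0 : ℝ)] (fun _ : ℝ => (1 : ℝ))) := by
  refine ⟨fun T hT => ⟨DivAlgPoly.isProbabilityMeasure_gibbsMeasure hP hT,
    (DivAlgPoly.hasDerivAt_freeEnergy hP hT).differentiableAt⟩,
    fun dM _ h => ⟨h.rootVolume_pos, h.rootVolume_lt_top hP, ?_⟩, fun h => ?_⟩
  -- The logarithm of the volume does not depend on `T` and is absorbed in `O(1)`.
  · simp only [← sub_sub]
    exact (h.entropy_sub_isBigO hP).sub (isBigO_const_const _ one_ne_zero _)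
  · simpa using h.isMorseBottRootManifold.entropy_sub_isBigO hP
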